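/- Let $m\ge 1$, let $\langle\cdot,\cdot\rangle$ be the standard scalar product on $\mathbb R^m$, and let $\mathbb R^m_+$ be the nonnegative orthant. For $M\in\mathbb R^{m\times m}$ and $q\in\mathbb R^m$, let $\mathrm{LCP}(M,q)$ be the problem of finding $x\in\mathbb R^m_+$ with $Mx+q\in\mathbb R^m_+$ and $\langle x,Mx+q\rangle=0$. Call $M$ a Q-matrix if $\mathrm{LCP}(M,q)$ has a solution for every $q\in\mathbb R^m$, a P-matrix if $\mathrm{LCP}(M,q)$ has exactly one solution for every $q\in\mathbb R^m$, and an F-matrix if $(M\mathbb R^m_++q)\cap\mathbb R^m_+\neq\varnothing$ for every $q\in\mathbb R^m$. The congruence orbit of $M$ is $\mathcal O(M)=\{L^\top ML: L\in GL_m(\mathbb R)\}$. Let $A\in GL_m(\mathbb R)$. Then exactly one of the following three alternatives holds. 1. $\langle Ax,x\rangle>0$ for all $x\in\mathbb R^m\setminus\{0\}$. 2. $\langle Ax,x\rangle\le 0$ for all $x\in\mathbb R^m$. 3. There are nonzero $x,y\in\mathbb R^m$ with $\langle Ax,x\rangle>0$ and $\langle Ay,y\rangle\le 0$. Moreover, alternative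 1 is equivalent to each of the following: every member of $\mathcal O(A)$ is an F-matrix; every member of $\mathcal O(A)$ is a Q-matrix; every member of $\mathcal O(A)$ is a P-matrix. If alternative 2 holds, then no member of $\mathcal O(A)$ is an F-matrix. If alternative 3 holds, then $\mathcal O(A)$ contains a matrix that is not an F-matrix, and it contains a Q-matrix. -/

import Mathlib

namespace CongruenceLCP

open Matrix

/-- The nonnegative orthant of `ℝ^m`. -/
def orthant (m : ℕ) : Set (Fin m → ℝ) := {x | ∀ i, 0 ≤ x i}

/-- The dual `K* = {y | ⟨x, y⟩ ≥ 0 for all x ∈ K}` with respect to the standard scalar product. -/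
def dualCone {m : ℕ} (K : Set (Fin m → ℝ)) : Set (Fin m → ℝ) :=
  {y | ∀ x ∈ K, 0 ≤ x ⬝ᵥ y}

/-- The solution set of the linear complementarity problem on `K`:
all `x ∈ K` with `M x + q ∈ K*` and `⟨x, M x + q⟩ = 0`. -/
def lcpSol {m : ℕ} (K : Set (Fin m → ℝ)) (M : Matrix (Fin m) (Fin m) ℝ) (q : Fin m → ℝ) :
    Set (Fin m → ℝ) :=
  {x | x ∈ K ∧ M *ᵥ x + q ∈ dualCone K ∧ x ⬝ᵥ (M *ᵥ x + q) = 0}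

/-- The `K`-Q-property: the complementarity problem is solvable for every `q`. -/
def HasQProperty {m : ℕ} (K : Set (Fin m → ℝ)) (M : Matrix (Fin m) (Fin m) ℝ) : Prop :=
  ∀ q : Fin m → ℝ, ∃ x, x ∈ lcpSol K M q

/-- The `K`-P-property: the complementarity problem is uniquely solvable for every `q`. -/
def HasPProperty {m : ℕ} (K : Set (Fin m → ℝ)) (M : Matrix (Fin m) (Fin m) ℝ) : Prop :=
  ∀ q : Fin m → ℝ, ∃! x, x ∈ lcpSol K M q

/-- The general feasibility property with respect to `K`: `(M K + q) ∩ K* ≠ ∅` for every `q`. -/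
def HasFProperty {m : ℕ} (K : Set (Fin m → ℝ)) (M : Matrix (Fin m) (Fin m) ℝ) : Prop :=
  ∀ q : Fin m → ℝ, (((fun x => M *ᵥ x + q) '' K) ∩ dualCone K).Nonempty

/-- Q-matrices: the Q-property for the nonnegative orthant. -/
def IsQMatrix {m : ℕ} (M : Matrix (Fin m) (Fin m) ℝ) : Prop := HasQProperty (orthant m) M

/-- P-matrices: the P-property for the nonnegative orthant. -/
def IsPMatrix {m : ℕ} (M : Matrix (Fin m) (Fin m) ℝ) : Prop := HasPProperty (orthant m) M

/-- F-matrices: the feasibility property for the nonnegative orthant. -/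
def IsFMatrix {m : ℕ} (M : Matrix (Fin m) (Fin m) ℝ) : Prop := HasFProperty (orthant m) M

/-- The congruence orbit `{Lᵀ M L | L ∈ GL_m(ℝ)}`. -/
def congruenceOrbit {m : ℕ} (M : Matrix (Fin m) (Fin m) ℝ) : Set (Matrix (Fin m) (Fin m) ℝ) :=
  {B | ∃ L : Matrix (Fin m) (Fin m) ℝ, IsUnit L ∧ B = Lᵀ * M * L}

/-- `⟨M x, x⟩ > 0` for all `x ≠ 0`; the matrix `M` need not be symmetric. -/
def PositiveDefinite {m : ℕ} (M : Matrix (Fin m) (Fin m) ℝ) : Prop :=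
  ∀ x : Fin m → ℝ, x ≠ 0 → 0 < (M *ᵥ x) ⬝ᵥ x

/-- `⟨M x, x⟩ ≤ 0` for all `x`. -/
def NegativeSemidefinite {m : ℕ} (M : Matrix (Fin m) (Fin m) ℝ) : Prop :=
  ∀ x : Fin m → ℝ, (M *ᵥ x) ⬝ᵥ x ≤ 0

/-- `⟨M x, x⟩ > 0` and `⟨M y, y⟩ ≤ 0` for some nonzero `x` and `y`. -/
def MixedSign {m : ℕ} (M : Matrix (Fin m) (Fin m) ℝ) : Prop :=
  (∃ x : Fin m → ℝ, x ≠ 0 ∧ 0 < (M *ᵥ x) ⬝ᵥ x) ∧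
    ∃ y : Fin m → ℝ, y ≠ 0 ∧ (M *ᵥ y) ⬝ᵥ y ≤ 0

end CongruenceLCP

namespace CongruenceLCP

open Matrix Filter Topology

/-! ### Orthant reformulations, congruence invariance, and failure of feasibility. -/

section Basic

variable {m : ℕ}

/-! Both sign conditions are congruence invariant. A positive definite matrix is a P-matrix: a
projected gradient step contracts, and positivity gives uniqueness. Conversely, a nonzero `y` of
nonpositive value can be made a basis vector; sign flips then give a nonpositive row, so feasibility
fails (`exists_not_isFMatrix`).

The hard part is a Q-matrix in the orbit as soon as some `x` has positive value
(`exists_isQMatrix_mem_congruenceOrbit`). Split off `x` as a corner whose column vanishes below it;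
the trailing block is the form on the left-orthogonal complement of `A x`. If that block takes a
positive value, recurse and use `isQMatrix_of_col_zero`. If it is negative definite, adding a long
multiple of `x` to a suitable basis of the complement makes the diagonal positive and minimal in
each column. A nonzero complement vector of value zero is removed by perturbing `x`, using
invertibility. -/

theorem mem_dualCone_orthant {y : Fin m → ℝ} : y ∈ dualCone (orthant m) ↔ ∀ i, 0 ≤ y i := by
  constructor
  · intro h i
    have := h (Pi.single i 1) (fun j => by
      by_cases hj : j = i
      · subst hj; simp
      · simp [Pi.single_eq_of_ne hj])
    simpa using this
  · intro h x hx
    exact Finset.sum_nonneg fun i _ => mul_nonneg (hx i) (h i)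

theorem mem_lcpSol_orthant {M : Matrix (Fin m) (Fin m) ℝ} {q x : Fin m → ℝ} :
    x ∈ lcpSol (orthant m) M q ↔
      (∀ i, 0 ≤ x i) ∧ (∀ i, 0 ≤ (M *ᵥ x) i + q i) ∧ x ⬝ᵥ (M *ᵥ x + q) = 0 := by
  refine and_congr Iff.rfl (and_congr ?_ Iff.rfl)
  rw [mem_dualCone_orthant]
  rfl

theorem mem_lcpSol_orthant_of_mul_eq_zero {M : Matrix (Fin m) (Fin m) ℝ} {q x : Fin m → ℝ}
    (hx : ∀ i, 0 ≤ x i) (hy : ∀ i, 0 ≤ (M *ᵥ x) i + q i)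
    (hxy : ∀ i, x i * ((M *ᵥ x) i + q i) = 0) : x ∈ lcpSol (orthant m) M q :=
  mem_lcpSol_orthant.2 ⟨hx, hy, Finset.sum_eq_zero fun i _ => hxy i⟩

theorem isFMatrix_iff {M : Matrix (Fin m) (Fin m) ℝ} :
    IsFMatrix M ↔ ∀ q : Fin m → ℝ, ∃ x : Fin m → ℝ,
      (∀ i, 0 ≤ x i) ∧ ∀ i, 0 ≤ (M *ᵥ x) i + q i := by
  refine forall_congr' fun q => ?_
  constructor
  · rintro ⟨_, ⟨x, hx, rfl⟩, h⟩
    exact ⟨x, hx, mem_dualCone_orthant.1 h⟩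
  · rintro ⟨x, hx, h⟩
    exact ⟨_, ⟨x, hx, rfl⟩, mem_dualCone_orthant.2 h⟩

theorem IsQMatrix.isFMatrix {M : Matrix (Fin m) (Fin m) ℝ} (h : IsQMatrix M) : IsFMatrix M := by
  intro q
  obtain ⟨x, hx, hy, -⟩ := h q
  exact ⟨_, ⟨x, hx, rfl⟩, hy⟩

theorem IsPMatrix.isQMatrix {M : Matrix (Fin m) (Fin m) ℝ} (h : IsPMatrix M) : IsQMatrix M :=
  fun q => (h q).exists

theorem dotProduct_congruence_mulVec (L A : Matrix (Fin m) (Fin m) ℝ) (x y : Fin m → ℝ) :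
    x ⬝ᵥ ((Lᵀ * A * L) *ᵥ y) = (L *ᵥ x) ⬝ᵥ (A *ᵥ (L *ᵥ y)) := by
  rw [Matrix.mul_assoc, ← mulVec_mulVec, ← mulVec_mulVec, dotProduct_mulVec, vecMul_transpose]

theorem congruence_apply (L A : Matrix (Fin m) (Fin m) ℝ) (i j : Fin m) :
    (Lᵀ * A * L) i j = L.col i ⬝ᵥ (A *ᵥ L.col j) := by
  have := dotProduct_congruence_mulVec L A (Pi.single i 1) (Pi.single j 1)
  simpa using this

theorem mem_congruenceOrbit_trans {A B C : Matrix (Fin m) (Fin m) ℝ}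
    (hC : C ∈ congruenceOrbit B) (hB : B ∈ congruenceOrbit A) : C ∈ congruenceOrbit A := by
  obtain ⟨L, hL, rfl⟩ := hB
  obtain ⟨N, hN, rfl⟩ := hC
  exact ⟨L * N, hL.mul hN, by simp [Matrix.mul_assoc, transpose_mul]⟩

theorem isUnit_of_mem_congruenceOrbit {A B : Matrix (Fin m) (Fin m) ℝ}
    (hB : B ∈ congruenceOrbit A) (hA : IsUnit A) : IsUnit B := by
  obtain ⟨L, hL, rfl⟩ := hB
  exact ((isUnit_transpose L).2 hL |>.mul hA).mul hL

theorem mulVec_ne_zero_of_isUnit {L : Matrix (Fin m) (Fin m) ℝ} (hL : IsUnit L)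
    {x : Fin m → ℝ} (hx : x ≠ 0) : L *ᵥ x ≠ 0 := fun h =>
  hx (mulVec_injective_of_isUnit hL (by simpa using h))

theorem PositiveDefinite.of_mem_congruenceOrbit {A B : Matrix (Fin m) (Fin m) ℝ}
    (hA : PositiveDefinite A) (hB : B ∈ congruenceOrbit A) : PositiveDefinite B := by
  obtain ⟨L, hL, rfl⟩ := hB
  intro x hx
  rw [dotProduct_comm, dotProduct_congruence_mulVec, dotProduct_comm]
  exact hA _ (mulVec_ne_zero_of_isUnit hL hx)

theorem NegativeSemidefinite.of_mem_congruenceOrbit {A B : Matrix (Fin m) (Fin m) ℝ}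
    (hA : NegativeSemidefinite A) (hB : B ∈ congruenceOrbit A) : NegativeSemidefinite B := by
  obtain ⟨L, hL, rfl⟩ := hB
  intro x
  rw [dotProduct_comm, dotProduct_congruence_mulVec, dotProduct_comm]
  exact hA _

theorem NegativeSemidefinite.not_isFMatrix (hm : 1 ≤ m) {A : Matrix (Fin m) (Fin m) ℝ}
    (hA : NegativeSemidefinite A) : ¬ IsFMatrix A := by
  intro hF
  -- With `q = -1` feasibility forces every entry of `A x` to be at least 1, so the value at `x`
  -- dominates the sum of its entries.
  obtain ⟨x, hx, hy⟩ := isFMatrix_iff.1 hF fun _ => -1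
  have hsum : ∑ i, x i ≤ (A *ᵥ x) ⬝ᵥ x :=
    Finset.sum_le_sum fun i _ => by nlinarith [hx i, hy i]
  have hx0 : x = 0 := by
    have h0 : ∑ i, x i = 0 :=
      le_antisymm (hsum.trans (hA x)) (Finset.sum_nonneg fun i _ => hx i)
    ext i
    exact (Finset.sum_eq_zero_iff_of_nonneg fun i _ => hx i).1 h0 i (Finset.mem_univ i)
  have := hy ⟨0, hm⟩
  simp [hx0] at this
  linarith

/-- A matrix with a nonpositive row is not an F-matrix. -/
theorem not_isFMatrix_of_row_nonpos {A : Matrix (Fin m) (Fin m) ℝ} (i : Fin m)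
    (h : ∀ j, A i j ≤ 0) : ¬ IsFMatrix A := by
  intro hF
  obtain ⟨x, hx, hy⟩ := isFMatrix_iff.1 hF fun _ => -1
  have h1 : ∑ j, A i j * x j ≤ 0 :=
    Finset.sum_nonpos fun j _ => mul_nonpos_of_nonpos_of_nonneg (h j) (hx j)
  have h2 : 0 ≤ ∑ j, A i j * x j + -1 := hy i
  linarith

/-- Replacing column `k` of the identity by `y` gives determinant `y k ≠ 0`; a column swap then
moves `y` to position `i`. -/
theorem exists_isUnit_col_eq {y : Fin m → ℝ} (hy : y ≠ 0) (i : Fin m) :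
    ∃ L : Matrix (Fin m) (Fin m) ℝ, IsUnit L ∧ L.col i = y := by
  obtain ⟨k, hk⟩ := Function.ne_iff.1 hy
  have h : IsUnit ((1 : Matrix (Fin m) (Fin m) ℝ).updateCol k y) := by
    rw [isUnit_iff_isUnit_det, ← cramer_apply, cramer_one]
    exact isUnit_iff_ne_zero.2 hk
  refine ⟨_, (isUnit_submatrix_equiv (Equiv.refl _) (Equiv.swap i k)).2 h, ?_⟩
  ext j
  simp [col]

theorem exists_not_isFMatrix {A : Matrix (Fin m) (Fin m) ℝ} {y : Fin m → ℝ} (hy : y ≠ 0)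
    (hAy : (A *ᵥ y) ⬝ᵥ y ≤ 0) : ∃ B ∈ congruenceOrbit A, ¬ IsFMatrix B := by
  obtain ⟨i, -⟩ := Function.ne_iff.1 hy
  obtain ⟨L, hL, hLy⟩ := exists_isUnit_col_eq hy i
  -- Flipping the basis vectors with a positive entry in row `i` makes that row nonpositive; vector
  -- `i` is `y` and needs no flip.
  set s : Fin m → ℝ := fun j => if (Lᵀ * A * L) i j ≤ 0 then 1 else -1 with hs
  have hsi : s i = 1 := by
    simp only [hs]
    rw [if_pos]
    rw [congruence_apply, hLy, dotProduct_comm]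
    exact hAy
  have hD : IsUnit (diagonal s) := by
    rw [isUnit_iff_isUnit_det, det_diagonal, isUnit_iff_ne_zero]
    refine Finset.prod_ne_zero_iff.2 fun j _ => ?_
    simp only [hs]
    split_ifs <;> norm_num
  refine ⟨(diagonal s)ᵀ * (Lᵀ * A * L) * diagonal s,
    mem_congruenceOrbit_trans ⟨_, hD, rfl⟩ ⟨L, hL, rfl⟩, not_isFMatrix_of_row_nonpos i fun j => ?_⟩
  rw [diagonal_transpose, mul_diagonal, diagonal_mul, hsi, one_mul]
  simp only [hs]
  split_ifs with h
  · simpa using h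
  · linarith

end Basic

/-! ### Positive definite matrices are P-matrices. -/

section PositiveDefinite

variable {m : ℕ}

/-- The Rayleigh quotient is scale invariant and attains its minimum on the compact sup-norm sphere.
-/
theorem PositiveDefinite.exists_coercive {M : Matrix (Fin m) (Fin m) ℝ} (hM : PositiveDefinite M) :
    ∃ c > 0, ∀ x : Fin m → ℝ, c * (x ⬝ᵥ x) ≤ x ⬝ᵥ (M *ᵥ x) := by
  rcases isEmpty_or_nonempty (Fin m) with hm | hm
  · exact ⟨1, one_pos, fun x => by simp [Subsingleton.elim x 0]⟩
  have hpos : ∀ x : Fin m → ℝ, x ≠ 0 → 0 < x ⬝ᵥ x := fun x hx =>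
    (Finset.sum_nonneg fun i _ => mul_self_nonneg (x i)).lt_of_ne
      (Ne.symm (dotProduct_self_eq_zero.not.2 hx))
  have hne : ∀ x ∈ Metric.sphere (0 : Fin m → ℝ) 1, x ≠ 0 := fun x hx =>
    ne_zero_of_mem_unit_sphere ⟨x, hx⟩
  obtain ⟨u, hu, hmin⟩ := (isCompact_sphere (0 : Fin m → ℝ) 1).exists_isMinOn
    (NormedSpace.sphere_nonempty.2 zero_le_one)
    (f := fun x => (x ⬝ᵥ (M *ᵥ x)) / (x ⬝ᵥ x))
    (ContinuousOn.div (by fun_prop) (by fun_prop) fun x hx => (hpos x (hne x hx)).ne')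
  have hMu : 0 < u ⬝ᵥ (M *ᵥ u) := by
    rw [dotProduct_comm]
    exact hM u (hne u hu)
  refine ⟨_, div_pos hMu (hpos u (hne u hu)), fun x => ?_⟩
  by_cases hx : x = 0
  · simp [hx]
  have hn : ‖x‖⁻¹ ≠ 0 := inv_ne_zero (norm_ne_zero_iff.2 hx)
  have h : (u ⬝ᵥ (M *ᵥ u)) / (u ⬝ᵥ u) ≤
      ((‖x‖⁻¹ • x) ⬝ᵥ (M *ᵥ (‖x‖⁻¹ • x))) / ((‖x‖⁻¹ • x) ⬝ᵥ (‖x‖⁻¹ • x)) :=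
    isMinOn_iff.1 hmin _ (by simp [norm_smul, hx])
  simp only [mulVec_smul, dotProduct_smul, smul_dotProduct, smul_eq_mul] at h
  rw [← le_div_iff₀ (hpos x hx)]
  refine le_of_le_of_eq h ?_
  rw [mul_div_mul_left _ _ hn, mul_div_mul_left _ _ hn]

theorem exists_mulVec_dotProduct_self_le (M : Matrix (Fin m) (Fin m) ℝ) :
    ∃ C ≥ 0, ∀ x : Fin m → ℝ, (M *ᵥ x) ⬝ᵥ (M *ᵥ x) ≤ C * (x ⬝ᵥ x) := by
  refine ⟨∑ i, ∑ j, M i j ^ 2, by positivity, fun x => ?_⟩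
  rw [Finset.sum_mul]
  refine Finset.sum_le_sum fun i _ => ?_
  have := Finset.sum_mul_sq_le_sq_mul_sq Finset.univ (M i) x
  simpa [mulVec, dotProduct, ← sq] using this

/-- A fixed point of the projected step `x ↦ max 0 (x - t (M x + q))` solves the problem. -/
theorem mem_lcpSol_of_eq_max {M : Matrix (Fin m) (Fin m) ℝ} {q x : Fin m → ℝ} {t : ℝ} (ht : 0 < t)
    (h : ∀ i, x i = max 0 (x i - t * ((M *ᵥ x) i + q i))) : x ∈ lcpSol (orthant m) M q := by
  have key : ∀ i, 0 ≤ x i ∧ 0 ≤ (M *ᵥ x) i + q i ∧ x i * ((M *ᵥ x) i + q i) = 0 := by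
    intro i
    have hi := h i
    rcases le_total (x i - t * ((M *ᵥ x) i + q i)) 0 with hle | hle
    · rw [max_eq_left hle] at hi
      rw [hi] at hle ⊢
      exact ⟨le_rfl, by nlinarith, by simp⟩
    · rw [max_eq_right hle] at hi
      have h0 : (M *ᵥ x) i + q i = 0 := by
        have : t * ((M *ᵥ x) i + q i) = 0 := by linarith
        exact (mul_eq_zero.1 this).resolve_left ht.ne'
      rw [h0] at hle ⊢
      exact ⟨by simpa using hle, le_rfl, by simp⟩
  exact mem_lcpSol_orthant_of_mul_eq_zero (fun i => (key i).1) (fun i => (key i).2.1)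
    fun i => (key i).2.2

theorem PositiveDefinite.exists_mem_lcpSol {M : Matrix (Fin m) (Fin m) ℝ}
    (hM : PositiveDefinite M) (q : Fin m → ℝ) : ∃ x, x ∈ lcpSol (orthant m) M q := by
  obtain ⟨c, hc, hcM⟩ := hM.exists_coercive
  obtain ⟨C, hC, hCM⟩ := exists_mulVec_dotProduct_self_le M
  -- The squared step is bounded by the factor `1 - 2ct + Ct²`, and `Ct ≤ c` for `t = c / D` reduces
  -- it to `1 - ct`. The summand `c ^ 2` keeps `D` positive and `ct ≤ 1`.
  set D : ℝ := C + c ^ 2 with hD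
  have hD0 : 0 < D := by positivity
  set t : ℝ := c / D with ht
  have ht0 : 0 < t := by positivity
  have htD : t * D = c := div_mul_cancel₀ _ hD0.ne'
  set k : ℝ := 1 - c * t with hk
  have hk1 : k < 1 := by nlinarith
  have hk0 : 0 ≤ k := by
    have : c * t ≤ 1 := by
      rw [ht, ← mul_div_assoc, div_le_one hD0]
      nlinarith
    linarith
  -- The contraction estimate lives in the Euclidean norm, not the sup norm of `Fin m → ℝ`.
  let T : EuclideanSpace ℝ (Fin m) → EuclideanSpace ℝ (Fin m) := fun x =>
    WithLp.toLp 2 fun i => max 0 (x i - t * ((M *ᵥ x.ofLp) i + q i))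
  have hT : ContractingWith (NNReal.sqrt k.toNNReal) T := by
    refine ⟨?_, LipschitzWith.of_dist_le_mul fun x y => ?_⟩
    · rw [← NNReal.sqrt_one]
      exact NNReal.sqrt_lt_sqrt.2 (Real.toNNReal_lt_one.2 hk1)
    · rw [EuclideanSpace.dist_eq, EuclideanSpace.dist_eq, Real.coe_sqrt, Real.coe_toNNReal k hk0,
        ← Real.sqrt_mul hk0]
      refine Real.sqrt_le_sqrt ?_
      set d : Fin m → ℝ := x.ofLp - y.ofLp with hd
      have hmax : ∀ a b : ℝ, |max 0 a - max 0 b| ≤ |a - b| := fun a b => by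
        simpa only [max_comm] using abs_max_sub_max_le_abs a b 0
      have h1 : ∀ i, dist (T x i) (T y i) ^ 2 ≤ (d i - t * (M *ᵥ d) i) ^ 2 := by
        intro i
        rw [Real.dist_eq, sq_abs]
        refine sq_le_sq.2 ((hmax _ _).trans_eq ?_)
        congr 1
        rw [hd, mulVec_sub]
        simp only [Pi.sub_apply]
        ring
      have h2 : ∑ i, (d i - t * (M *ᵥ d) i) ^ 2
          = d ⬝ᵥ d - 2 * t * (d ⬝ᵥ (M *ᵥ d)) + t ^ 2 * ((M *ᵥ d) ⬝ᵥ (M *ᵥ d)) := by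
        simp only [dotProduct, Finset.mul_sum, ← Finset.sum_sub_distrib, ← Finset.sum_add_distrib]
        exact Finset.sum_congr rfl fun i _ => by ring
      have h3 : ∑ i, dist (x i) (y i) ^ 2 = d ⬝ᵥ d := by
        refine Finset.sum_congr rfl fun i _ => ?_
        rw [Real.dist_eq, sq_abs, sq]
        rfl
      have h4 : 0 ≤ d ⬝ᵥ d := Finset.sum_nonneg fun i _ => mul_self_nonneg _
      rw [h3]
      refine (Finset.sum_le_sum fun i _ => h1 i).trans ?_
      rw [h2]
      have h5 := mul_le_mul_of_nonneg_left (hcM d) ht0.le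
      have h6 := mul_le_mul_of_nonneg_left (hCM d) (sq_nonneg t)
      have h7 : t ^ 2 * (C * (d ⬝ᵥ d)) ≤ t * c * (d ⬝ᵥ d) := by
        have : t ^ 2 * C ≤ t * c := by
          rw [← htD]
          nlinarith [mul_pos ht0 ht0, mul_pos hc hc]
        nlinarith
      rw [hk]
      nlinarith
  refine ⟨(hT.fixedPoint T).ofLp, mem_lcpSol_of_eq_max ht0 fun i => ?_⟩
  exact (congrArg (fun z : EuclideanSpace ℝ (Fin m) => z i) hT.fixedPoint_isFixedPt.eq).symm

theorem PositiveDefinite.isPMatrix {M : Matrix (Fin m) (Fin m) ℝ} (hM : PositiveDefinite M) :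
    IsPMatrix M := by
  intro q
  obtain ⟨x, hx⟩ := hM.exists_mem_lcpSol q
  refine ⟨x, hx, fun y hy => ?_⟩
  obtain ⟨hx0, hx1, hx2⟩ := mem_lcpSol_orthant.1 hx
  obtain ⟨hy0, hy1, hy2⟩ := mem_lcpSol_orthant.1 hy
  by_contra hne
  have hpos := hM (y - x) (sub_ne_zero.2 hne)
  -- The value of the form at `y - x` is minus the sum of these two cross terms, hence nonpositive.
  have hxy : 0 ≤ x ⬝ᵥ (M *ᵥ y + q) := Finset.sum_nonneg fun i _ => mul_nonneg (hx0 i) (hy1 i)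
  have hyx : 0 ≤ y ⬝ᵥ (M *ᵥ x + q) := Finset.sum_nonneg fun i _ => mul_nonneg (hy0 i) (hx1 i)
  rw [dotProduct_comm, mulVec_sub] at hpos
  simp only [dotProduct_add, dotProduct_sub, sub_dotProduct] at *
  linarith

end PositiveDefinite

/-! ### Block matrices and splitting off a vector. -/

section NormalForm

variable {n : ℕ}

/-- The block diagonal matrix with blocks `s` and `L`. -/
def borderDiag (s : ℝ) (L : Matrix (Fin n) (Fin n) ℝ) : Matrix (Fin (n + 1)) (Fin (n + 1)) ℝ :=
  of (Fin.cons (Fin.cons s 0) fun i => Fin.cons 0 (L i))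

@[simp] theorem borderDiag_zero_zero (s : ℝ) (L : Matrix (Fin n) (Fin n) ℝ) :
    borderDiag s L 0 0 = s := rfl

@[simp] theorem borderDiag_zero_succ (s : ℝ) (L : Matrix (Fin n) (Fin n) ℝ) (j : Fin n) :
    borderDiag s L 0 j.succ = 0 := rfl

@[simp] theorem borderDiag_succ_zero (s : ℝ) (L : Matrix (Fin n) (Fin n) ℝ) (i : Fin n) :
    borderDiag s L i.succ 0 = 0 := rfl

@[simp] theorem borderDiag_succ_succ (s : ℝ) (L : Matrix (Fin n) (Fin n) ℝ) (i j : Fin n) :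
    borderDiag s L i.succ j.succ = L i j := rfl

theorem isUnit_of_col_zero {A : Matrix (Fin (n + 1)) (Fin (n + 1)) ℝ}
    (h : ∀ i : Fin n, A i.succ 0 = 0) :
    IsUnit A ↔ A 0 0 ≠ 0 ∧ IsUnit (A.submatrix Fin.succ Fin.succ) := by
  rw [isUnit_iff_isUnit_det, isUnit_iff_isUnit_det, det_succ_column_zero, Fin.sum_univ_succ]
  simp [h, mul_eq_zero, Fin.succAbove_zero]

theorem isUnit_borderDiag {s : ℝ} (hs : s ≠ 0) {L : Matrix (Fin n) (Fin n) ℝ} (hL : IsUnit L) :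
    IsUnit (borderDiag s L) :=
  (isUnit_of_col_zero fun _ => rfl).2 ⟨hs, hL⟩

theorem borderDiag_congruence_zero_zero (s : ℝ) (L : Matrix (Fin n) (Fin n) ℝ)
    (A : Matrix (Fin (n + 1)) (Fin (n + 1)) ℝ) :
    ((borderDiag s L)ᵀ * A * borderDiag s L) 0 0 = s ^ 2 * A 0 0 := by
  simp [mul_apply, Fin.sum_univ_succ]
  ring

theorem borderDiag_congruence_zero_succ (s : ℝ) (L : Matrix (Fin n) (Fin n) ℝ)
    (A : Matrix (Fin (n + 1)) (Fin (n + 1)) ℝ) (j : Fin n) :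
    ((borderDiag s L)ᵀ * A * borderDiag s L) 0 j.succ = s * ∑ k, A 0 (Fin.succ k) * L k j := by
  simp [mul_apply, Fin.sum_univ_succ, Finset.mul_sum, mul_assoc]

theorem borderDiag_congruence_succ_zero (s : ℝ) (L : Matrix (Fin n) (Fin n) ℝ)
    {A : Matrix (Fin (n + 1)) (Fin (n + 1)) ℝ} (h : ∀ i : Fin n, A i.succ 0 = 0) (i : Fin n) :
    ((borderDiag s L)ᵀ * A * borderDiag s L) i.succ 0 = 0 := by
  simp [mul_apply, Fin.sum_univ_succ, h]

theorem borderDiag_congruence_succ_succ (s : ℝ) (L : Matrix (Fin n) (Fin n) ℝ)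
    (A : Matrix (Fin (n + 1)) (Fin (n + 1)) ℝ) (i j : Fin n) :
    ((borderDiag s L)ᵀ * A * borderDiag s L) i.succ j.succ =
      (Lᵀ * A.submatrix Fin.succ Fin.succ * L) i j := by
  simp [mul_apply, Fin.sum_univ_succ]

/-- A vector of positive value can be split off, up to congruence, from one side. -/
theorem exists_congruence_col_zero (A : Matrix (Fin (n + 1)) (Fin (n + 1)) ℝ)
    {x : Fin (n + 1) → ℝ} (hx : 0 < x ⬝ᵥ (A *ᵥ x)) :
    ∃ L : Matrix (Fin (n + 1)) (Fin (n + 1)) ℝ, IsUnit L ∧ L.col 0 = x ∧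
      ∀ i : Fin n, (Lᵀ * A * L) i.succ 0 = 0 := by
  have hx0 : x ≠ 0 := by
    rintro rfl
    simp at hx
  obtain ⟨L, hL, hLx⟩ := exists_isUnit_col_eq hx0 0
  set B := Lᵀ * A * L with hB
  have hB0 : B 0 0 ≠ 0 := by
    rw [hB, congruence_apply, hLx]
    exact hx.ne'
  -- Each other basis vector is corrected by a multiple of `x` so that it becomes left-orthogonal to
  -- `A x`.
  let E : Matrix (Fin (n + 1)) (Fin (n + 1)) ℝ :=
    (1 : Matrix _ _ ℝ).updateRow 0 (Fin.cons 1 fun j => -(B j.succ 0 / B 0 0))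
  have hE0 : E 0 0 = 1 := by simp [E]
  have hEs : ∀ i : Fin n, E i.succ 0 = 0 := fun i => by simp [E, updateRow_apply]
  have hE0s : ∀ i : Fin n, E 0 i.succ = -(B i.succ 0 / B 0 0) := fun i => by simp [E]
  have hEss : ∀ i j : Fin n, E i.succ j.succ = (1 : Matrix (Fin n) (Fin n) ℝ) i j := fun i j => by
    simp [E, updateRow_apply, one_apply]
  have hE : IsUnit E := by
    refine (isUnit_of_col_zero hEs).2 ⟨by simp [hE0], ?_⟩
    convert isUnit_one
    ext i j
    exact hEss i j
  refine ⟨L * E, hL.mul hE, ?_, fun i => ?_⟩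
  · ext i
    simp only [← hLx, col_apply, mul_apply, Fin.sum_univ_succ, hE0, hEs]
    simp
  · have : (L * E)ᵀ * A * (L * E) = Eᵀ * B * E := by
      simp [hB, transpose_mul, Matrix.mul_assoc]
    rw [this]
    simp only [mul_apply, transpose_apply, Fin.sum_univ_succ, hE0, hEs, hE0s, hEss, one_apply]
    simp [hB0]

end NormalForm

/-! ### Construction of Q-matrices in the orbit. -/

section QMatrix

/-- If the diagonal is positive and minimal in every column, then a multiple of a coordinate vector
solves the complementarity problem. -/
theorem isQMatrix_of_diag_le {m : ℕ} (hm : 1 ≤ m) {M : Matrix (Fin m) (Fin m) ℝ}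
    (h0 : ∀ i, 0 < M i i) (h : ∀ i j, M i i ≤ M j i) : IsQMatrix M := by
  intro q
  have : Nonempty (Fin m) := ⟨⟨0, hm⟩⟩
  obtain ⟨i, hi⟩ := Finite.exists_min q
  rcases le_total 0 (q i) with hq | hq
  · exact ⟨0, mem_lcpSol_orthant_of_mul_eq_zero (by simp) (fun j => by simpa using hq.trans (hi j))
      (by simp)⟩
  -- This `t` annihilates residual `i`; the others are no smaller, since both `q` and column `i` of
  -- `M` are minimal at `i`.
  · set t : ℝ := -q i / M i i with ht
    have ht0 : 0 ≤ t := div_nonneg (by linarith) (h0 i).le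
    have htM : M i i * t = -q i := mul_div_cancel₀ _ (h0 i).ne'
    have hMx : ∀ j, (M *ᵥ Pi.single i t) j = M j i * t := fun j => by simp
    refine ⟨Pi.single i t, mem_lcpSol_orthant_of_mul_eq_zero (fun j => ?_) (fun j => ?_)
      fun j => ?_⟩
    · by_cases hj : j = i
      · subst hj; simpa using ht0
      · simp [hj]
    · rw [hMx]
      nlinarith [mul_le_mul_of_nonneg_right (h i j) ht0, hi j]
    · by_cases hj : j = i
      · subst hj
        rw [hMx, htM]
        simp
      · simp [hj]

/-- A block triangular matrix is a Q-matrix when its diagonal blocks are. -/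
theorem isQMatrix_of_col_zero {n : ℕ} {M : Matrix (Fin (n + 1)) (Fin (n + 1)) ℝ}
    (h0 : 0 < M 0 0) (h : ∀ i : Fin n, M i.succ 0 = 0)
    (hM : IsQMatrix (M.submatrix Fin.succ Fin.succ)) : IsQMatrix M := by
  intro q
  obtain ⟨y, hy⟩ := hM (Fin.tail q)
  obtain ⟨hy0, hy1, hy2⟩ := mem_lcpSol_orthant.1 hy
  -- Once the trailing block is solved, a scalar complementarity problem with slope `M 0 0` and
  -- constant `r` remains.
  set r : ℝ := ∑ j : Fin n, M 0 j.succ * y j + q 0 with hr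
  set t : ℝ := max 0 (-r / M 0 0) with ht
  have hz : (M *ᵥ Fin.cons t y) 0 + q 0 = M 0 0 * t + r := by
    simp [mulVec, dotProduct, Fin.sum_univ_succ, hr, add_assoc]
  have hs : ∀ i : Fin n, (M *ᵥ Fin.cons t y) i.succ + q i.succ =
      (M.submatrix Fin.succ Fin.succ *ᵥ y) i + Fin.tail q i := fun i => by
    simp [mulVec, dotProduct, Fin.sum_univ_succ, h, Fin.tail]
  have hdiv : M 0 0 * (-r / M 0 0) = -r := mul_div_cancel₀ _ h0.ne'
  refine ⟨Fin.cons t y, mem_lcpSol_orthant.2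
    ⟨Fin.cases (le_max_left _ _) hy0, ?_, ?_⟩⟩
  · refine Fin.cases ?_ fun i => ?_
    · rw [hz]
      nlinarith [mul_le_mul_of_nonneg_left (le_max_right 0 (-r / M 0 0)) h0.le]
    · rw [hs]
      exact hy1 i
  · have h1 : t * (M 0 0 * t + r) = 0 := by
      rcases le_total (-r / M 0 0) 0 with hle | hle
      · rw [ht, max_eq_left hle, zero_mul]
      · rw [ht, max_eq_right hle, hdiv]
        simp
    simp only [dotProduct, Fin.sum_univ_succ, Pi.add_apply, hz, Fin.cons_zero, Fin.cons_succ, hs, h1, zero_add]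
    exact hy2

theorem exists_pos_forall_mul_le {n : ℕ} (f g : Fin n → ℝ) (hg : ∀ i, 0 < g i) :
    ∃ s > 0, ∀ i, s * f i ≤ g i := by
  have h : ∀ᶠ s : ℝ in 𝓝[>] 0, ∀ i, s * f i < g i := by
    refine eventually_all.2 fun i => nhdsWithin_le_nhds ?_
    have : Tendsto (fun s : ℝ => s * f i) (𝓝 0) (𝓝 (0 * f i)) :=
      (continuous_id.mul continuous_const).tendsto 0
    rw [zero_mul] at this
    exact this.eventually_lt_const (hg i)
  obtain ⟨s, hs, hs0⟩ := (h.and self_mem_nhdsWithin).exists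
  exact ⟨s, hs0, fun i => (hs i).le⟩

theorem cons_zero_dotProduct_mulVec {n : ℕ} (A : Matrix (Fin (n + 1)) (Fin (n + 1)) ℝ)
    (x y : Fin n → ℝ) :
    (Fin.cons 0 x : Fin (n + 1) → ℝ) ⬝ᵥ (A *ᵥ Fin.cons 0 y) =
      x ⬝ᵥ (A.submatrix Fin.succ Fin.succ *ᵥ y) := by
  simp [mulVec, dotProduct, Fin.sum_univ_succ]

theorem cons_zero_ne_zero {n : ℕ} {x : Fin n → ℝ} (hx : x ≠ 0) :
    (Fin.cons 0 x : Fin (n + 1) → ℝ) ≠ 0 := fun h =>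
  hx (funext fun i => by simpa using congrFun h i.succ)

/-- A positive definite form has a basis in which the diagonal is maximal in every column. -/
theorem PositiveDefinite.exists_le_diag : ∀ {n : ℕ} {N : Matrix (Fin n) (Fin n) ℝ},
    PositiveDefinite N → ∃ L : Matrix (Fin n) (Fin n) ℝ, IsUnit L ∧
      ∀ i j, (Lᵀ * N * L) j i ≤ (Lᵀ * N * L) i i
  | 0, _, _ => ⟨1, isUnit_one, fun i => i.elim0⟩
  | n + 1, N, hN => by
    have he : 0 < (Pi.single 0 1 : Fin (n + 1) → ℝ) ⬝ᵥ (N *ᵥ Pi.single 0 1) := by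
      rw [dotProduct_comm]
      exact hN _ (by simp)
    obtain ⟨L₁, hL₁, -, hcol⟩ := exists_congruence_col_zero N he
    set B := L₁ᵀ * N * L₁ with hB
    have hBpd : PositiveDefinite B := hN.of_mem_congruenceOrbit ⟨L₁, hL₁, rfl⟩
    have hC : PositiveDefinite (B.submatrix Fin.succ Fin.succ) := fun x hx => by
      rw [dotProduct_comm, ← cons_zero_dotProduct_mulVec, dotProduct_comm]
      exact hBpd _ (cons_zero_ne_zero hx)
    have hdiag : ∀ {k : ℕ} {D : Matrix (Fin k) (Fin k) ℝ}, PositiveDefinite D →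
        ∀ i, 0 < D i i := fun hD i => by
      simpa using hD (Pi.single i 1) (by simp)
    obtain ⟨L₂, hL₂, hle⟩ := PositiveDefinite.exists_le_diag hC
    have hCpd := hC.of_mem_congruenceOrbit ⟨L₂, hL₂, rfl⟩
    -- Shrinking the first basis vector scales the rest of row 0 by `s` and leaves the trailing
    -- block alone.
    obtain ⟨s, hs, hsle⟩ := exists_pos_forall_mul_le
      (fun j => ∑ k, B 0 (Fin.succ k) * L₂ k j) _ (hdiag hCpd)
    refine ⟨L₁ * borderDiag s L₂, hL₁.mul (isUnit_borderDiag hs.ne' hL₂), ?_⟩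
    have : (L₁ * borderDiag s L₂)ᵀ * N * (L₁ * borderDiag s L₂) =
        (borderDiag s L₂)ᵀ * B * borderDiag s L₂ := by
      simp [hB, transpose_mul, Matrix.mul_assoc]
    rw [this]
    refine Fin.cases (Fin.cases le_rfl fun j => ?_) fun i => Fin.cases ?_ fun j => ?_
    · rw [borderDiag_congruence_succ_zero _ _ hcol, borderDiag_congruence_zero_zero]
      exact (mul_pos (by positivity) (hdiag hBpd 0)).le
    · rw [borderDiag_congruence_zero_succ, borderDiag_congruence_succ_succ]
      exact hsle i
    · rw [borderDiag_congruence_succ_succ, borderDiag_congruence_succ_succ]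
      exact hle i j

theorem exists_isQMatrix_of_neg_submatrix {n : ℕ} {A : Matrix (Fin (n + 1)) (Fin (n + 1)) ℝ}
    (h0 : 0 < A 0 0) (h : ∀ i : Fin n, A i.succ 0 = 0)
    (hneg : PositiveDefinite (-A.submatrix Fin.succ Fin.succ)) :
    ∃ B ∈ congruenceOrbit A, IsQMatrix B := by
  obtain ⟨L, hL, hle⟩ := hneg.exists_le_diag
  have hNpd := hneg.of_mem_congruenceOrbit ⟨L, hL, rfl⟩
  set N := Lᵀ * (-A.submatrix Fin.succ Fin.succ) * L with hN
  have hNpos : ∀ i, 0 < N i i := fun i => by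
    simpa only [mulVec_single_one, dotProduct_single_one, col_apply] using
      hNpd (Pi.single i 1) (by simp)
  set f : Fin n → ℝ := fun j => ∑ k, A 0 (Fin.succ k) * L k j with hf
  -- The later diagonal entries will be `K² A₀₀ + K fᵢ - Nᵢᵢ`, which this choice of `K` makes
  -- positive.
  obtain ⟨K, hK1, hK⟩ : ∃ K : ℝ, 1 ≤ K ∧ ∀ i, N i i - f i < K * A 0 0 :=
    ((eventually_ge_atTop 1).and (eventually_all.2 fun i =>
      (tendsto_id.atTop_mul_const h0).eventually_gt_atTop _)).exists
  have hK0 : 0 < K := by linarith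
  set D := (borderDiag K L)ᵀ * A * borderDiag K L with hD
  have hDorb : D ∈ congruenceOrbit A := ⟨_, isUnit_borderDiag hK0.ne' hL, rfl⟩
  have hD00 : D 0 0 = K ^ 2 * A 0 0 := borderDiag_congruence_zero_zero _ _ _
  have hD0s : ∀ j : Fin n, D 0 j.succ = K * f j := borderDiag_congruence_zero_succ _ _ _
  have hDs0 : ∀ i : Fin n, D i.succ 0 = 0 := borderDiag_congruence_succ_zero _ _ h
  have hDss : ∀ i j : Fin n, D i.succ j.succ = -N i j := fun i j => by
    rw [hD, borderDiag_congruence_succ_succ, hN]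
    simp
  -- the new basis is `e₀, e₀ + e₁, e₀ + e₂, …`
  let G : Matrix (Fin (n + 1)) (Fin (n + 1)) ℝ := (1 : Matrix _ _ ℝ).updateRow 0 fun _ => 1
  have hG0 : ∀ j, G 0 j = 1 := fun j => by simp [G]
  have hGs : ∀ i : Fin n, G i.succ 0 = 0 := fun i => by simp [G, updateRow_apply]
  have hGss : ∀ i j : Fin n, G i.succ j.succ = (1 : Matrix (Fin n) (Fin n) ℝ) i j := fun i j => by
    simp [G, updateRow_apply, one_apply]
  have hG : IsUnit G := by
    refine (isUnit_of_col_zero hGs).2 ⟨by simp [hG0], ?_⟩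
    convert isUnit_one
    ext i j
    exact hGss i j
  have hB0 : ∀ i, (Gᵀ * D * G) i 0 = K ^ 2 * A 0 0 := by
    refine Fin.cases ?_ fun i => ?_ <;>
    simp [mul_apply, Fin.sum_univ_succ, hG0, hGs, hGss, hD00, hDs0]
  have hB0s : ∀ j : Fin n, (Gᵀ * D * G) 0 j.succ = K ^ 2 * A 0 0 + K * f j := fun j => by
    simp [mul_apply, Fin.sum_univ_succ, hG0, hGs, hGss, hD00, hD0s, one_apply]
  have hBss : ∀ i j : Fin n,
      (Gᵀ * D * G) i.succ j.succ = K ^ 2 * A 0 0 + K * f j - N i j := fun i j => by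
    simp [mul_apply, Fin.sum_univ_succ, hG0, hGss, hD00, hD0s, hDs0, hDss, one_apply]
    ring
  refine ⟨Gᵀ * D * G, mem_congruenceOrbit_trans ⟨G, hG, rfl⟩ hDorb,
    isQMatrix_of_diag_le (Nat.le_add_left 1 n) (Fin.cases ?_ fun i => ?_)
      (Fin.cases (fun j => ?_) fun i => Fin.cases ?_ fun j => ?_)⟩
  · rw [hB0]
    positivity
  · rw [hBss]
    nlinarith [mul_lt_mul_of_pos_left (hK i) hK0, mul_le_mul_of_nonneg_right hK1 (hNpos i).le]
  · rw [hB0, hB0]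
  · rw [hBss, hB0s]
    linarith [hNpos i]
  · rw [hBss, hBss]
    linarith [hle i j]

/-- A degenerate left-orthogonal complement of a positive vector can be perturbed into one
containing a vector of positive value. -/
theorem exists_pos_pair_of_degenerate {m : ℕ} {A : Matrix (Fin m) (Fin m) ℝ} (hA : IsUnit A)
    {x h : Fin m → ℝ} (hx : 0 < x ⬝ᵥ (A *ᵥ x)) (hh : h ≠ 0) (hhx : h ⬝ᵥ (A *ᵥ x) = 0)
    (hhh : h ⬝ᵥ (A *ᵥ h) = 0) :
    ∃ x u : Fin m → ℝ, 0 < x ⬝ᵥ (A *ᵥ x) ∧ u ⬝ᵥ (A *ᵥ x) = 0 ∧ 0 < u ⬝ᵥ (A *ᵥ u) := by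
  -- Moving `x` along `w` changes its pairing with `h` at first order, because `h ⬝ᵥ (A *ᵥ w) = w ⬝ᵥ
  -- w`.
  set w : Fin m → ℝ := Aᵀ *ᵥ h with hw
  have hw0 : w ≠ 0 := mulVec_ne_zero_of_isUnit ((isUnit_transpose A).2 hA) hh
  have hβ : 0 < h ⬝ᵥ (A *ᵥ w) := by
    rw [dotProduct_mulVec, ← mulVec_transpose]
    exact (Finset.sum_nonneg fun i _ => mul_self_nonneg (w i)).lt_of_ne
      (Ne.symm (dotProduct_self_eq_zero.not.2 hw0))
  set a := x ⬝ᵥ (A *ᵥ x) with ha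
  set β := h ⬝ᵥ (A *ᵥ w) with hβ'
  set δ := x ⬝ᵥ (A *ᵥ h) with hδ
  -- The direction of the move is chosen so that the cross term `x ⬝ᵥ (A *ᵥ h)` cannot lower the
  -- value of the new `u`.
  obtain ⟨σ, hσ0, hσ⟩ : ∃ σ : ℝ, σ ≠ 0 ∧ σ * δ ≤ 0 := by
    rcases le_total δ 0 with hd | hd
    · exact ⟨1, by norm_num, by linarith⟩
    · exact ⟨-1, by norm_num, by linarith⟩
  have hev : ∀ᶠ t : ℝ in 𝓝[>] 0, 0 < a + t * σ * (x ⬝ᵥ (A *ᵥ w)) ∧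
      0 < a + t * σ * (x ⬝ᵥ (A *ᵥ w)) + t * σ * (w ⬝ᵥ (A *ᵥ x)) +
        (t * σ) ^ 2 * (w ⬝ᵥ (A *ᵥ w)) := by
    refine nhdsWithin_le_nhds (Filter.Eventually.and ?_ ?_)
    · exact ContinuousAt.eventually_lt (by fun_prop) (by fun_prop) (by simpa using hx)
    · exact ContinuousAt.eventually_lt (by fun_prop) (by fun_prop) (by simpa using hx)
  obtain ⟨t, ⟨hγ, hx'⟩, ht⟩ := (hev.and self_mem_nhdsWithin).exists
  have ht : 0 < t := ht
  set γ := a + t * σ * (x ⬝ᵥ (A *ᵥ w)) with hγ'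
  refine ⟨x + (t * σ) • w, γ • h - (t * σ * β) • x, ?_, ?_, ?_⟩
  · refine lt_of_lt_of_eq hx' ?_
    simp only [mulVec_add, mulVec_smul, dotProduct_add, add_dotProduct, dotProduct_smul,
      smul_dotProduct, smul_eq_mul, ← ha, hγ']
    ring
  · simp only [mulVec_add, mulVec_smul, dotProduct_add, sub_dotProduct, dotProduct_smul,
      smul_dotProduct, smul_eq_mul, ← ha, ← hβ', hhx, hγ']
    ring
  · have : 0 < (t * σ * β) ^ 2 * a - γ * t * β * (σ * δ) := by
      have h1 : 0 < (t * σ * β) ^ 2 * a := by positivity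
      have h2 : γ * t * β * (σ * δ) ≤ 0 := mul_nonpos_of_nonneg_of_nonpos (by positivity) hσ
      linarith
    refine lt_of_lt_of_eq this ?_
    simp only [mulVec_sub, mulVec_smul, dotProduct_sub, sub_dotProduct, dotProduct_smul,
      smul_dotProduct, smul_eq_mul, ← ha, ← hδ, hhx, hhh]
    ring

theorem exists_pos_pair_or_neg {m : ℕ} {A : Matrix (Fin m) (Fin m) ℝ} (hA : IsUnit A)
    {x : Fin m → ℝ} (hx : 0 < x ⬝ᵥ (A *ᵥ x)) :
    (∃ x u : Fin m → ℝ, 0 < x ⬝ᵥ (A *ᵥ x) ∧ u ⬝ᵥ (A *ᵥ x) = 0 ∧ 0 < u ⬝ᵥ (A *ᵥ u)) ∨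
      ∀ u : Fin m → ℝ, u ≠ 0 → u ⬝ᵥ (A *ᵥ x) = 0 → u ⬝ᵥ (A *ᵥ u) < 0 := by
  refine or_iff_not_imp_left.2 fun hno u hu hux => ?_
  rcases lt_trichotomy (u ⬝ᵥ (A *ᵥ u)) 0 with hlt | heq | hgt
  · exact hlt
  · exact absurd (exists_pos_pair_of_degenerate hA hx hu hux heq) hno
  · exact absurd ⟨x, u, hx, hux, hgt⟩ hno

theorem exists_isQMatrix_mem_congruenceOrbit : ∀ {m : ℕ} {A : Matrix (Fin m) (Fin m) ℝ},
    IsUnit A → ∀ {x : Fin m → ℝ}, 0 < x ⬝ᵥ (A *ᵥ x) → ∃ B ∈ congruenceOrbit A, IsQMatrix B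
  | 0, _, _, x, hx => by simp [Subsingleton.elim x 0] at hx
  | n + 1, A, hA, x, hx => by
    rcases exists_pos_pair_or_neg hA hx with ⟨x, u, hx, hux, hu⟩ | hneg
    · obtain ⟨L, hL, hLx, hcol⟩ := exists_congruence_col_zero A hx
      set B := Lᵀ * A * L with hB
      have hBorb : B ∈ congruenceOrbit A := ⟨L, hL, rfl⟩
      have hB0 : 0 < B 0 0 := by
        rw [hB, congruence_apply, hLx]
        exact hx
      obtain ⟨w, rfl⟩ := (mulVec_surjective_iff_isUnit.2 hL) u
      -- Column 0 vanishes below the corner, so left-orthogonality of `u` says exactly that its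
      -- first coordinate is zero.
      have hw0 : w 0 = 0 := by
        have hx_eq : x = L *ᵥ Pi.single 0 1 := by rw [mulVec_single_one, hLx]
        rw [hx_eq, ← dotProduct_congruence_mulVec, mulVec_single_one, ← hB, dotProduct,
          Fin.sum_univ_succ] at hux
        simpa [hcol, hB0.ne'] using hux
      have hw : 0 < Fin.tail w ⬝ᵥ (B.submatrix Fin.succ Fin.succ *ᵥ Fin.tail w) := by
        have hcons : (Fin.cons 0 (Fin.tail w) : Fin (n + 1) → ℝ) = w := by
          rw [← hw0, Fin.cons_self_tail]
        rw [← cons_zero_dotProduct_mulVec, hcons, hB, dotProduct_congruence_mulVec]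
        exact hu
      obtain ⟨-, hC⟩ := (isUnit_of_col_zero hcol).1 (isUnit_of_mem_congruenceOrbit hBorb hA)
      obtain ⟨_, ⟨N, hN, rfl⟩, hQ⟩ := exists_isQMatrix_mem_congruenceOrbit hC hw
      refine ⟨_, mem_congruenceOrbit_trans ⟨borderDiag 1 N, isUnit_borderDiag one_ne_zero hN, rfl⟩
        hBorb, isQMatrix_of_col_zero ?_ (borderDiag_congruence_succ_zero _ _ hcol) ?_⟩
      · rw [borderDiag_congruence_zero_zero]
        positivity
      · convert hQ using 1
        ext i j
        exact borderDiag_congruence_succ_succ _ _ _ i j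
    · obtain ⟨L, hL, hLx, hcol⟩ := exists_congruence_col_zero A hx
      set B := Lᵀ * A * L with hB
      have hB0 : 0 < B 0 0 := by
        rw [hB, congruence_apply, hLx]
        exact hx
      have hpd : PositiveDefinite (-B.submatrix Fin.succ Fin.succ) := fun v hv => by
        rw [dotProduct_comm, neg_mulVec, dotProduct_neg, ← cons_zero_dotProduct_mulVec, hB,
          dotProduct_congruence_mulVec]
        refine neg_pos.2 (hneg _ (mulVec_ne_zero_of_isUnit hL (cons_zero_ne_zero hv)) ?_)
        rw [← hLx, ← mulVec_single_one, ← dotProduct_congruence_mulVec, mulVec_single_one, ← hB,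
          dotProduct, Fin.sum_univ_succ]
        simp [hcol]
      obtain ⟨C, hC, hQ⟩ := exists_isQMatrix_of_neg_submatrix hB0 hcol hpd
      exact ⟨C, mem_congruenceOrbit_trans hC ⟨L, hL, rfl⟩, hQ⟩

end QMatrix

/-! ### The three alternatives and the final assembly. -/

theorem sign_trichotomy {m : ℕ} (A : Matrix (Fin m) (Fin m) ℝ) :
    PositiveDefinite A ∨ NegativeSemidefinite A ∨ MixedSign A := by
  by_cases h1 : PositiveDefinite A
  · exact Or.inl h1
  by_cases h2 : NegativeSemidefinite A
  · exact Or.inr (Or.inl h2)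
  unfold PositiveDefinite at h1
  unfold NegativeSemidefinite at h2
  push Not at h1 h2
  obtain ⟨x, hx⟩ := h2
  exact Or.inr (Or.inr ⟨⟨x, by rintro rfl; simp at hx, hx⟩, h1⟩)

end CongruenceLCP

theorem corollary6p14 (m : ℕ) (hm : 1 ≤ m) (A : Matrix (Fin m) (Fin m) ℝ) (hA : IsUnit A) :
    -- exactly one of the three alternatives holds
    ((CongruenceLCP.PositiveDefinite A ∨ CongruenceLCP.NegativeSemidefinite A ∨
          CongruenceLCP.MixedSign A) ∧
        ¬ (CongruenceLCP.PositiveDefinite A ∧ CongruenceLCP.NegativeSemidefinite A) ∧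
        ¬ (CongruenceLCP.PositiveDefinite A ∧ CongruenceLCP.MixedSign A) ∧
        ¬ (CongruenceLCP.NegativeSemidefinite A ∧ CongruenceLCP.MixedSign A)) ∧
      -- the equivalent descriptions of the first alternative
      List.TFAE [
        CongruenceLCP.PositiveDefinite A,
        ∀ B ∈ CongruenceLCP.congruenceOrbit A, CongruenceLCP.IsFMatrix B,
        ∀ B ∈ CongruenceLCP.congruenceOrbit A, CongruenceLCP.IsQMatrix B,
        ∀ B ∈ CongruenceLCP.congruenceOrbit A, CongruenceLCP.IsPMatrix B] ∧
      -- the consequence of the second alternative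
      (CongruenceLCP.NegativeSemidefinite A →
        ∀ B ∈ CongruenceLCP.congruenceOrbit A, ¬ CongruenceLCP.IsFMatrix B) ∧
      -- the consequence of the third alternative
      (CongruenceLCP.MixedSign A →
        (∃ B ∈ CongruenceLCP.congruenceOrbit A, ¬ CongruenceLCP.IsFMatrix B) ∧
          ∃ B ∈ CongruenceLCP.congruenceOrbit A, CongruenceLCP.IsQMatrix B) := by
  open CongruenceLCP in
  refine ⟨⟨sign_trichotomy A, ?_, ?_, ?_⟩, ?_, fun h B hB => ?_, ?_⟩
  · rintro ⟨hp, hn⟩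
    have : Nonempty (Fin m) := ⟨⟨0, hm⟩⟩
    obtain ⟨x, hx⟩ := exists_ne (0 : Fin m → ℝ)
    exact (hp x hx).not_ge (hn x)
  · rintro ⟨hp, -, y, hy, hle⟩
    exact (hp y hy).not_ge hle
  · rintro ⟨hn, ⟨x, -, hlt⟩, -⟩
    exact hlt.not_ge (hn x)
  · tfae_have 1 → 4 := fun h B hB => (h.of_mem_congruenceOrbit hB).isPMatrix
    tfae_have 4 → 3 := fun h B hB => (h B hB).isQMatrix
    tfae_have 3 → 2 := fun h B hB => (h B hB).isFMatrix
    tfae_have 2 → 1 := by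
      intro h y hy
      by_contra hle
      obtain ⟨B, hB, hF⟩ := exists_not_isFMatrix hy (not_lt.1 hle)
      exact hF (h B hB)
    tfae_finish
  · exact (h.of_mem_congruenceOrbit hB).not_isFMatrix hm
  · rintro ⟨⟨x, -, hx⟩, y, hy, hle⟩
    rw [dotProduct_comm] at hx
    exact ⟨exists_not_isFMatrix hy hle, exists_isQMatrix_mem_congruenceOrbit hA hx⟩
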